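/- Let $d$ be a positive integer, let $\mathcal A\subset\mathbb R^d$ be the affine hyperplane $x_1+\dots+x_d=1$, let $\Delta=\{x\in\mathcal A:\ x_1>0,\dots,x_d>0\}$ be the standard open $(d-1)$-dimensional simplex, and let $c=(1/d,\dots,1/d)$ be its center. Let $\operatorname{vol}$ denote $(d-1)$-dimensional volume on $\mathcal A$ for the Euclidean structure induced from $\mathbb R^d$. Let $H\subset\mathcal A$ be an affine hyperplane in $\mathcal A$ (a nonempty affine subspace of codimension one) that intersects $\Delta$. If $c\notin H$, let $H^-\subset\mathcal A$ be the open halfspace of $\mathcal A$ bounded by $H$ that does not contain $c$; if $c\in H$, let $H^-$ be either of the two open halfspaces of $\mathcal A$ bounded by $H$. Suppose that the function $f(x)=\sum_{i=1}^d\ln x_i$ attains its maximum on $\Delta\cap H$ at the point $a$. Then $$d^d e^{f(a)}\ \ge\ \frac{\operatorname{vol}(\Delta\cap H^-)}{\operatorname{vol}(\Delta)}\ \ge\ \frac{\gamma}{d^2}\,d^d e^{f(a)}\qquad\text{with } \gamma=\frac1{2e^3}.$$ -/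

import Mathlib

namespace SimplexSection

noncomputable section

/-- The affine hyperplane `x_1 + … + x_d = 1` in `ℝ^d`. -/
def ambient (d : ℕ) : AffineSubspace ℝ (EuclideanSpace ℝ (Fin d)) where
  carrier := {x | ∑ i, x i = 1}
  smul_vsub_vadd_mem' := by
    intro t p q r hp hq hr
    change ∑ i, _ = 1 at hp hq hr ⊢
    simp [Finset.sum_add_distrib, ← Finset.mul_sum, hp, hq, hr]

/-- The standard open simplex `Δ` in the hyperplane `x_1 + … + x_d = 1`. -/
def simplex (d : ℕ) : Set (EuclideanSpace ℝ (Fin d)) :=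
  {x | x ∈ ambient d ∧ ∀ i, 0 < x i}

/-- The center `c = (1/d, …, 1/d)` of the simplex. -/
def center (d : ℕ) : EuclideanSpace ℝ (Fin d) :=
  WithLp.toLp 2 (fun _ => 1 / (d : ℝ))

/-- The `(d-1)`-dimensional Lebesgue measure on the direction space of the hyperplane
`x_1 + … + x_d = 1`, for the Euclidean structure induced from `ℝ^d`: the translation-invariant
measure that gives measure 1 to the parallelepiped spanned by an orthonormal basis. -/
def directionVolume (d : ℕ) : MeasureTheory.Measure (ambient d).direction :=
  (stdOrthonormalBasis ℝ (ambient d).direction).toBasis.addHaar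

/-- The `(d-1)`-dimensional Euclidean volume of a subset `S` of the hyperplane
`x_1 + … + x_d = 1`. The hyperplane is identified with its direction space by
`v ↦ c + v`; the choice of base point does not matter, by translation invariance. -/
def vol (d : ℕ) (S : Set (EuclideanSpace ℝ (Fin d))) : ℝ :=
  (directionVolume d).real {v | center d + (v : EuclideanSpace ℝ (Fin d)) ∈ S}

/-- `H` is an affine hyperplane in the hyperplane `x_1 + … + x_d = 1`, that is, a nonempty affine
subspace of it of codimension one. -/
structure IsHyperplane (d : ℕ) (H : AffineSubspace ℝ (EuclideanSpace ℝ (Fin d))) : Prop where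
  nonempty : (H : Set (EuclideanSpace ℝ (Fin d))).Nonempty
  le_ambient : H ≤ ambient d
  codim_one : Module.finrank ℝ H.direction + 1 = Module.finrank ℝ (ambient d).direction

/-- `S` is one of the two open halfspaces of the hyperplane `x_1 + … + x_d = 1` bounded by the
affine hyperplane `H` in it. -/
def IsOpenHalfspace (d : ℕ) (H : AffineSubspace ℝ (EuclideanSpace ℝ (Fin d)))
    (S : Set (EuclideanSpace ℝ (Fin d))) : Prop :=
  ∃ (u : EuclideanSpace ℝ (Fin d)) (b : ℝ),
    (H : Set (EuclideanSpace ℝ (Fin d))) = {x | x ∈ ambient d ∧ inner ℝ u x = b} ∧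
    S = {x | x ∈ ambient d ∧ inner ℝ u x < b}

/-- The function `f(x) = ∑ ln x_i`. -/
def logSum (d : ℕ) (x : EuclideanSpace ℝ (Fin d)) : ℝ :=
  ∑ i, Real.log (x i)

end

end SimplexSection

/-!
Replace the uniform point of the simplex by a vector `x` of independent standard exponential
variables: normalized to sum `1` it is uniform, so the share of the simplex cut out by a cone is the
probability of the cone (`vol_inter_cone_div_vol`).

Let `a` be the maximum point. If `a` is not the center, Lagrange multipliers show that `H` is given by
`∑ xᵢ / aᵢ = d` and `Hminus` by `∑ xᵢ / aᵢ < d`; the sign is settled by the inequality between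
arithmetic and harmonic means. Substituting `xᵢ = d aᵢ yᵢ` in the exponential integral over the cone
`∑ xᵢ / aᵢ < d ∑ xᵢ` gives `∏ (d aᵢ) * E[e^{-Z}; Z > 0]`, with `Z = ∑ (d aᵢ - 1) yᵢ` of mean zero
(`expPi_cone_eq_prod_mul_tiltedMass`), and `d ^ d * e^{f(a)} = ∏ (d aᵢ)`. The upper bound holds since
the expectation is at most `1`. If `a` is the center, then `∏ (d aᵢ) = 1` and the share is
`P(Z > 0) ≥ E[e^{-Z}; Z > 0]` for a suitable `Z` of the same kind.

Both lower bounds thus come from `E[e^{-Z}; Z > 0] ≥ 1 / (2 e³ d²)` for `Z = ∑ αᵢ yᵢ` with `∑ αᵢ = 0`,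
`α ≠ 0` and `αᵢ ≥ -1` (`le_tiltedMass_of_sum_eq_zero`). The distribution function `F` of `Z` is
log-concave, because convolution with an exponential law preserves log-concavity
(`IsLogConcave.conv_exp`). With mean zero this gives `1/e ≤ F(0) ≤ 1 - 1/e`
(`exp_neg_one_le_measureReal_lt`), while `F(4d) ≥ 3/4` by Markov's inequality. By log-concavity a fair
share of the growth of `F` from `0` to `4d` takes place on `[0, 1]`, where `e^{-Z} ≥ 1/e`.
-/

open MeasureTheory ProbabilityTheory Set
open scoped ENNReal

namespace SimplexSection

/-! ### Product measures on `ℝⁿ` -/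

lemma lintegral_pi_succ {n : ℕ} (m : Fin (n + 1) → Measure ℝ) [∀ i, SigmaFinite (m i)]
    {f : (Fin (n + 1) → ℝ) → ℝ≥0∞} (hf : Measurable f) :
    ∫⁻ y, f y ∂Measure.pi m =
      ∫⁻ t, ∫⁻ y, f (Fin.cons t y) ∂Measure.pi (fun i : Fin n => m i.succ) ∂(m 0) := by
  have h := (measurePreserving_piFinSuccAbove m 0).symm
  have hm : Measurable fun p => f ((MeasurableEquiv.piFinSuccAbove (fun _ => ℝ) 0).symm p) :=
    hf.comp (MeasurableEquiv.measurable _)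
  rw [← h.lintegral_comp hf, lintegral_prod _ hm.aemeasurable]
  simp [MeasurableEquiv.piFinSuccAbove, Fin.insertNthEquiv]

lemma measurable_finCons {n : ℕ} :
    Measurable (fun p : ℝ × (Fin n → ℝ) => (Fin.cons p.1 p.2 : Fin (n + 1) → ℝ)) := by
  refine measurable_pi_lambda _ fun i => ?_
  refine Fin.cases ?_ (fun j => ?_) i
  · simpa using measurable_fst
  · simpa [Function.comp_def] using (measurable_pi_apply j).comp measurable_snd

/-- A coordinatewise change of variables in a product measure: if each `m i` is the image under
`T i` of `m' i` with density `ρ i`, then the product of the `m i` is the image under the product map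
of the product of the `m' i` with the product density. -/
lemma lintegral_pi_change {n : ℕ} (m m' : Fin n → Measure ℝ) [∀ i, SigmaFinite (m i)]
    [∀ i, SigmaFinite (m' i)] (T : Fin n → ℝ → ℝ) (ρ : Fin n → ℝ → ℝ≥0∞)
    (hT : ∀ i, Measurable (T i)) (hρ : ∀ i, Measurable (ρ i))
    (h : ∀ i (f : ℝ → ℝ≥0∞), Measurable f → ∫⁻ y, f y ∂(m i) = ∫⁻ y, f (T i y) * ρ i y ∂(m' i))
    {f : (Fin n → ℝ) → ℝ≥0∞} (hf : Measurable f) :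
    ∫⁻ y, f y ∂Measure.pi m =
      ∫⁻ y, f (fun i => T i (y i)) * ∏ i, ρ i (y i) ∂Measure.pi m' := by
  induction n with
  | zero =>
    simp only [Measure.pi_of_empty _ (0 : Fin 0 → ℝ), lintegral_dirac, Finset.univ_eq_empty,
      Finset.prod_empty, mul_one]
    congr 1
    exact Subsingleton.elim _ _
  | succ n ih =>
    have hTm : Measurable fun (y : Fin (n + 1) → ℝ) i => T i (y i) :=
      measurable_pi_lambda _ fun i => (hT i).comp (measurable_pi_apply i)
    have hρm : Measurable fun y : Fin (n + 1) → ℝ => ∏ i, ρ i (y i) :=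
      Finset.measurable_prod _ fun i _ => (hρ i).comp (measurable_pi_apply i)
    have hTm' : Measurable fun (y : Fin n → ℝ) i => T i.succ (y i) :=
      measurable_pi_lambda _ fun i => (hT i.succ).comp (measurable_pi_apply i)
    have hρm' : Measurable fun y : Fin n → ℝ => ∏ i, ρ i.succ (y i) :=
      Finset.measurable_prod _ fun i _ => (hρ i.succ).comp (measurable_pi_apply i)
    have hprod : Measurable fun y : Fin (n + 1) → ℝ =>
        f (fun i => T i (y i)) * ∏ i, ρ i (y i) := (hf.comp hTm).mul hρm
    rw [lintegral_pi_succ m hf, lintegral_pi_succ m' hprod]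
    have hcons : Measurable fun p : ℝ × (Fin n → ℝ) => f (Fin.cons p.1 p.2 : Fin (n + 1) → ℝ) :=
      hf.comp measurable_finCons
    have hint : Measurable fun t => ∫⁻ y, f (Fin.cons t y : Fin (n + 1) → ℝ)
        ∂Measure.pi (fun i : Fin n => m i.succ) := hcons.lintegral_prod_right'
    rw [h 0 _ hint]
    refine lintegral_congr fun t => ?_
    have hft : Measurable fun y : Fin n → ℝ => f (Fin.cons (T 0 t) y : Fin (n + 1) → ℝ) :=
      hf.comp (measurable_finCons.comp (measurable_const.prodMk measurable_id))
    have hftm : Measurable fun y : Fin n → ℝ =>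
        f (Fin.cons (T 0 t) (fun i => T i.succ (y i)) : Fin (n + 1) → ℝ) *
          ∏ i, ρ i.succ (y i) := (hft.comp hTm').mul hρm'
    rw [ih (fun i => m i.succ) (fun i => m' i.succ) (fun i => T i.succ) (fun i => ρ i.succ)
      (fun i => hT _) (fun i => hρ _) (fun i => h _) hft,
      ← lintegral_mul_const _ hftm]
    refine lintegral_congr fun y => ?_
    rw [Fin.prod_univ_succ, mul_assoc, mul_comm (∏ i : Fin n, _)]
    simp only [Fin.cons_zero, Fin.cons_succ]
    congr 2
    ext i
    refine Fin.cases ?_ (fun j => ?_) i <;> simp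

/-! ### The standard exponential distribution -/

instance : IsProbabilityMeasure (expMeasure 1) := isProbabilityMeasure_expMeasure one_pos

lemma lintegral_expMeasure {f : ℝ → ℝ≥0∞} (hf : Measurable f) :
    ∫⁻ y, f y ∂(expMeasure 1) = ∫⁻ y in Ioi 0, f y * ENNReal.ofReal (Real.exp (-y)) := by
  have hm : Measurable (exponentialPDF 1) := (measurable_exponentialPDFReal 1).ennreal_ofReal
  have : expMeasure 1 = volume.withDensity (exponentialPDF 1) := rfl
  rw [this, lintegral_withDensity_eq_lintegral_mul _ hm hf,
    ← lintegral_add_compl _ (measurableSet_Ici (a := (0 : ℝ))), compl_Ici]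
  rw [setLIntegral_congr_fun (g := fun _ => 0) measurableSet_Iio
    (fun x hx => by simp [exponentialPDF_of_neg hx]), lintegral_zero, add_zero,
    setLIntegral_congr Ioi_ae_eq_Ici.symm]
  refine setLIntegral_congr_fun measurableSet_Ioi fun x hx => ?_
  simp [exponentialPDF_of_nonneg (le_of_lt hx), mul_comm]

lemma ae_pos_expMeasure : ∀ᵐ y ∂(expMeasure 1), 0 < y := by
  have h : {y : ℝ | ¬ 0 < y} = Iic 0 := by ext; simp
  rw [ae_iff, h, ← lintegral_indicator_one measurableSet_Iic,
    lintegral_expMeasure (measurable_one.indicator measurableSet_Iic)]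
  refine (setLIntegral_congr_fun (g := fun _ => 0) measurableSet_Ioi fun x hx => ?_).trans
    lintegral_zero
  simp [indicator, not_le.2 (mem_Ioi.1 hx)]

/-- Exponential tilting: `x = b y` turns the exponential density in `x` into the one in `y`, up to
the weight `b e^{(1 - b) y}`. -/
lemma lintegral_expMeasure_tilt {b : ℝ} (hb : 0 < b) {f : ℝ → ℝ≥0∞} (hf : Measurable f) :
    ∫⁻ y, f y ∂(expMeasure 1) =
      ∫⁻ y, f (b * y) * ENNReal.ofReal (b * Real.exp ((1 - b) * y)) ∂(expMeasure 1) := by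
  rw [lintegral_expMeasure hf, lintegral_expMeasure (by fun_prop)]
  have himg : (fun y => b * y) '' Ioi 0 = Ioi 0 := by
    simp [Set.image_const_mul_Ioi_zero hb]
  have := lintegral_image_eq_lintegral_abs_deriv_mul (s := Ioi (0 : ℝ)) measurableSet_Ioi
    (f := fun y => b * y) (f' := fun _ => b)
    (fun x _ => by simpa using ((hasDerivAt_id x).const_mul b).hasDerivWithinAt)
    (fun x _ y _ h => by simpa [hb.ne'] using h) (fun x => f x * ENNReal.ofReal (Real.exp (-x)))
  rw [himg] at this
  rw [this]
  refine lintegral_congr fun y => ?_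
  rw [abs_of_pos hb, mul_left_comm, mul_assoc, ← ENNReal.ofReal_mul hb.le,
    ← ENNReal.ofReal_mul (by positivity), mul_assoc, ← Real.exp_add]
  congr 4
  ring

/-- Memorylessness of the exponential distribution. -/
lemma lintegral_expMeasure_add {s : ℝ} (hs : 0 ≤ s) {f : ℝ → ℝ≥0∞} (hf : Measurable f) :
    ∫⁻ y, f y ∂(expMeasure 1) =
      (∫⁻ y in Ioc 0 s, f y * ENNReal.ofReal (Real.exp (-y))) +
        ENNReal.ofReal (Real.exp (-s)) * ∫⁻ y, f (y + s) ∂(expMeasure 1) := by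
  rw [lintegral_expMeasure hf, lintegral_expMeasure (by fun_prop), ← Ioc_union_Ioi_eq_Ioi hs,
    lintegral_union measurableSet_Ioi
      (Set.disjoint_left.2 fun x hx hx' => absurd hx.2 (not_le.2 hx'))]
  congr 1
  rw [Ioc_union_Ioi_eq_Ioi hs, ← lintegral_const_mul _ (by fun_prop)]
  have := (measurePreserving_add_right (volume : Measure ℝ) s).setLIntegral_comp_preimage
    (s := Ioi s) measurableSet_Ioi (f := fun y => f y * ENNReal.ofReal (Real.exp (-y)))
    (by fun_prop)
  rw [← this]
  simp only [preimage_add_const_Ioi, sub_self]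
  refine lintegral_congr fun y => ?_
  rw [mul_left_comm, ← ENNReal.ofReal_mul (Real.exp_pos _).le, ← Real.exp_add]
  congr 3
  ring

/-! ### Log-concavity of distribution functions -/

/-- Log-concavity of a function on the line, in a form that needs neither positivity nor
continuity: moving two arguments towards each other, with their sum fixed, does not decrease the
product of the values. -/
def IsLogConcave (g : ℝ → ℝ≥0∞) : Prop :=
  ∀ ⦃p q r s : ℝ⦄, p ≤ q → p ≤ r → p + s = q + r → g p * g s ≤ g q * g r

lemma IsLogConcave.comp_mul {g : ℝ → ℝ≥0∞} (hg : IsLogConcave g) (c : ℝ) :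
    IsLogConcave fun t => g (c * t) := by
  intro p q r s hpq hpr h
  have h' : c * p + c * s = c * q + c * r := by rw [← mul_add, h, mul_add]
  rcases le_total 0 c with hc | hc
  · exact hg (mul_le_mul_of_nonneg_left hpq hc) (mul_le_mul_of_nonneg_left hpr hc) h'
  · rw [mul_comm (g _)]
    exact hg (mul_le_mul_of_nonpos_left (by linarith) hc)
      (mul_le_mul_of_nonpos_left (by linarith) hc) (by linarith)

/-- Convolution with the exponential law preserves log-concavity. By memorylessness the function
`G = g * exp` satisfies `G(x + s) = I(x) + e^{-s} G(x)`, where `I(x)` integrates `g(x + s - w) e^{-w}`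
over `0 < w ≤ s`. In the product inequality for `G` the terms `e^{-s} G(a) G(y)` cancel, and the rest
follows from the inequality for `g` under the double integral. -/
lemma IsLogConcave.conv_exp {g : ℝ → ℝ≥0∞} (hg : IsLogConcave g) (hm : Measurable g) :
    IsLogConcave fun t => ∫⁻ y, g (t - y) ∂(expMeasure 1) := by
  intro a q y e haq hay h
  obtain ⟨s, rfl⟩ : ∃ s, q = a + s := ⟨q - a, by ring⟩
  obtain rfl : e = y + s := by linarith
  have hs : 0 ≤ s := by linarith
  have split (x : ℝ) : ∫⁻ v, g (x + s - v) ∂(expMeasure 1) =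
      (∫⁻ v in Ioc 0 s, g (x + s - v) * ENNReal.ofReal (Real.exp (-v))) +
        ENNReal.ofReal (Real.exp (-s)) * ∫⁻ v, g (x - v) ∂(expMeasure 1) := by
    rw [lintegral_expMeasure_add hs (by fun_prop)]
    simp
  simp only [split]
  rw [mul_add, add_mul]
  refine add_le_add ?_ (le_of_eq (by ring))
  rw [mul_comm, ← lintegral_mul_const _ (by fun_prop), ← lintegral_mul_const _ (by fun_prop)]
  refine setLIntegral_mono (by fun_prop) fun w hw => ?_
  rw [← lintegral_const_mul _ (by fun_prop), ← lintegral_const_mul _ (by fun_prop)]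
  refine lintegral_mono_ae ?_
  filter_upwards [ae_pos_expMeasure] with v hv
  -- `a - v` is the smallest of the four arguments, as `v ≥ 0`, `w ≤ s` and `a ≤ y`
  have := hg (p := a - v) (q := a + s - w) (r := y - v) (s := y + s - w)
    (by linarith [hw.2]) (by linarith) (by ring)
  calc g (y + s - w) * ENNReal.ofReal (Real.exp (-w)) * g (a - v)
      = g (a - v) * g (y + s - w) * ENNReal.ofReal (Real.exp (-w)) := by ring
    _ ≤ g (a + s - w) * g (y - v) * ENNReal.ofReal (Real.exp (-w)) := by gcongr
    _ = _ := by ring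

lemma IsLogConcave.conv_mul_exp {g : ℝ → ℝ≥0∞} (hg : IsLogConcave g) (hm : Measurable g)
    (c : ℝ) : IsLogConcave fun t => ∫⁻ y, g (t - c * y) ∂(expMeasure 1) := by
  rcases eq_or_ne c 0 with rfl | hc
  · simpa using hg
  · have := ((hg.comp_mul c).conv_exp (by fun_prop)).comp_mul c⁻¹
    convert! this using 4 with t y
    field_simp

/-- The joint law of `n` independent standard exponential variables. -/
noncomputable abbrev expPi (n : ℕ) : Measure (Fin n → ℝ) := Measure.pi fun _ => expMeasure 1

lemma IsLogConcave.conv_sum_exp {n : ℕ} (α : Fin n → ℝ) {g : ℝ → ℝ≥0∞} (hg : IsLogConcave g)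
    (hm : Measurable g) : IsLogConcave fun t => ∫⁻ y, g (t - ∑ i, α i * y i) ∂(expPi n) := by
  induction n with
  | zero => simpa using hg
  | succ n ih =>
    have hG := ih (fun i => α i.succ)
    have hGm : Measurable fun t => ∫⁻ y, g (t - ∑ i, α i.succ * y i) ∂(expPi n) := by
      have : Measurable fun p : ℝ × (Fin n → ℝ) => g (p.1 - ∑ i, α i.succ * p.2 i) := by fun_prop
      exact this.lintegral_prod_right'
    convert! hG.conv_mul_exp hGm (α 0) using 2 with t
    rw [lintegral_pi_succ _ (by fun_prop)]
    refine lintegral_congr fun s => lintegral_congr fun y => ?_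
    simp [Fin.sum_univ_succ, sub_sub]

lemma isLogConcave_measure_lt {n : ℕ} (α : Fin n → ℝ) :
    IsLogConcave fun t => expPi n {y | ∑ i, α i * y i < t} := by
  have hg : IsLogConcave ((Ioi (0 : ℝ)).indicator 1) := by
    intro p q r s hpq hpr h
    by_cases hp : 0 < p
    · simp [indicator, hp, hp.trans_le hpq, hp.trans_le hpr, ite_le_one]
    · simp [indicator, hp]
  convert! hg.conv_sum_exp α (measurable_one.indicator measurableSet_Ioi) using 2 with t
  rw [← lintegral_indicator_one (measurableSet_lt (by fun_prop) measurable_const)]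
  refine lintegral_congr fun y => ?_
  simp [indicator]

lemma isLogConcave_measure_le {n : ℕ} (α : Fin n → ℝ) :
    IsLogConcave fun t => expPi n {y | ∑ i, α i * y i ≤ t} := by
  have hg : IsLogConcave ((Ici (0 : ℝ)).indicator 1) := by
    intro p q r s hpq hpr h
    by_cases hp : 0 ≤ p
    · simp [indicator, hp, hp.trans hpq, hp.trans hpr]
      split_ifs <;> simp
    · simp [indicator, hp]
  convert! hg.conv_sum_exp α (measurable_one.indicator measurableSet_Ici) using 2 with t
  rw [← lintegral_indicator_one (measurableSet_le (by fun_prop) measurable_const)]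
  refine lintegral_congr fun y => ?_
  simp [indicator]

/-! ### Centroid inequality and small values of weighted sums of exponentials -/

/-- A monotone function `L` that satisfies the four-point concavity inequality has a supporting
line at `0`. Monotonicity replaces continuity: slopes are compared on lattices of vanishing step. -/
lemma exists_slope_of_monotone {L : ℝ → ℝ} (hmono : Monotone L)
    (hL : ∀ ⦃p q r s : ℝ⦄, p ≤ q → p ≤ r → p + s = q + r → L p + L s ≤ L q + L r) :
    ∃ r, 0 ≤ r ∧ ∀ t, L t ≤ L 0 + r * t := by
  -- On a lattice of step `δ`, the increment `L 0 - L (-δ)` bounds those to the right from above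
  -- and those to the left from below.
  have up (δ : ℝ) (hδ : 0 ≤ δ) (m : ℕ) : L (m * δ) - L 0 ≤ m * (L 0 - L (-δ)) := by
    induction m with
    | zero => simp
    | succ m ih =>
      have := hL (p := -δ) (q := 0) (r := m * δ) (s := (m + 1 : ℕ) * δ) (by linarith)
        (by have : 0 ≤ m * δ := by positivity
            linarith) (by push_cast; ring)
      push_cast at this ⊢
      linarith
  have down (δ : ℝ) (hδ : 0 ≤ δ) (n : ℕ) : n * (L 0 - L (-δ)) ≤ L 0 - L (-(n * δ)) := by
    induction n with
    | zero => simp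
    | succ n ih =>
      have := hL (p := -((n + 1 : ℕ) * δ)) (q := -(n * δ)) (r := -δ) (s := 0)
        (by push_cast; nlinarith) (by push_cast; nlinarith [mul_nonneg n.cast_nonneg hδ])
        (by push_cast; ring)
      push_cast at this ⊢
      linarith
  have key (s t : ℝ) (hs : 0 < s) (ht : 0 < t) : (L t - L 0) / t ≤ (L 0 - L (-s)) / s := by
    rw [div_le_div_iff₀ ht hs]
    have hC : 0 ≤ L 0 - L (-s) := sub_nonneg.2 (hmono (by linarith))
    have step (n : ℕ) (hn : 0 < n) :
        (L t - L 0) * s ≤ (L 0 - L (-s)) * t + (L 0 - L (-s)) * s / n := by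
      have hn' : (0 : ℝ) < n := by exact_mod_cast hn
      have hδ : 0 < s / n := by positivity
      have h1 := up (s / n) hδ.le ⌈t / (s / n)⌉₊
      have h2 := down (s / n) hδ.le n
      rw [mul_div_cancel₀ _ hn'.ne'] at h2
      have h3 : L t ≤ L (⌈t / (s / n)⌉₊ * (s / n)) :=
        hmono ((div_le_iff₀ hδ).1 (Nat.le_ceil _))
      have h4 : (⌈t / (s / n)⌉₊ : ℝ) ≤ t / (s / n) + 1 := (Nat.ceil_lt_add_one (by positivity)).le
      have h5 : L 0 - L (-(s / n)) ≤ (L 0 - L (-s)) / n := by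
        rw [le_div_iff₀ hn']; linarith
      have h6 : (⌈t / (s / n)⌉₊ : ℝ) * (L 0 - L (-(s / n))) ≤
          (t / (s / n) + 1) * ((L 0 - L (-s)) / n) :=
        mul_le_mul h4 h5 (sub_nonneg.2 (hmono (by linarith))) (by positivity)
      calc (L t - L 0) * s ≤ ((t / (s / n) + 1) * ((L 0 - L (-s)) / n)) * s := by
            gcongr; linarith
        _ = _ := by field_simp
    have hlim : Filter.Tendsto (fun n : ℕ => (L 0 - L (-s)) * t + (L 0 - L (-s)) * s / n)
        Filter.atTop (nhds ((L 0 - L (-s)) * t + 0)) :=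
      tendsto_const_nhds.add (tendsto_const_div_atTop_nhds_zero_nat _)
    rw [add_zero] at hlim
    exact ge_of_tendsto hlim (Filter.eventually_atTop.2 ⟨1, fun n hn => step n hn⟩)
  let A : Set ℝ := {x | ∃ t, 0 < t ∧ x = (L t - L 0) / t}
  have hA : A.Nonempty := ⟨_, 1, one_pos, rfl⟩
  have hbdd (s : ℝ) (hs : 0 < s) : (L 0 - L (-s)) / s ∈ upperBounds A := by
    rintro _ ⟨t, ht, rfl⟩
    exact key s t hs ht
  have hle (t : ℝ) (ht : 0 < t) : (L t - L 0) / t ≤ sSup A :=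
    le_csSup ⟨_, hbdd 1 one_pos⟩ ⟨t, ht, rfl⟩
  refine ⟨sSup A, le_trans ?_ (hle 1 one_pos), fun t => ?_⟩
  · simpa using hmono (zero_le_one' ℝ)
  · rcases lt_trichotomy t 0 with ht | rfl | ht
    · have := csSup_le hA (hbdd (-t) (by linarith))
      rw [le_div_iff₀ (by linarith), neg_neg] at this
      linarith
    · simp
    · have := hle t ht
      rw [div_le_iff₀ ht] at this
      linarith

lemma integrable_id_expMeasure : Integrable (fun y : ℝ => y) (expMeasure 1) ∧
    ∫ y, y ∂(expMeasure 1) = 1 := by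
  have hl : ∫⁻ y, ENNReal.ofReal y ∂(expMeasure 1) = 1 := by
    rw [lintegral_expMeasure ENNReal.measurable_ofReal]
    have h1 := Real.Gamma_eq_integral (s := 2) (by norm_num)
    have h2 := Real.GammaIntegral_convergent (s := 2) (by norm_num)
    rw [Real.Gamma_two] at h1
    rw [← ENNReal.ofReal_one, h1, ofReal_integral_eq_lintegral_ofReal h2]
    · refine setLIntegral_congr_fun measurableSet_Ioi fun x hx => ?_
      have hx' : (0 : ℝ) ≤ x := le_of_lt hx
      rw [← ENNReal.ofReal_mul hx', mul_comm]
      norm_num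
    · filter_upwards [ae_restrict_mem measurableSet_Ioi] with x hx
      have hx' : (0 : ℝ) < x := hx
      positivity
  have hpos : 0 ≤ᵐ[expMeasure 1] fun y : ℝ => y := ae_pos_expMeasure.mono fun y hy => hy.le
  refine ⟨(lintegral_ofReal_ne_top_iff_integrable (by fun_prop) hpos).1 (by simp [hl]), ?_⟩
  rw [integral_eq_lintegral_of_nonneg_ae hpos (by fun_prop), hl, ENNReal.toReal_one]

lemma integrable_sum_expPi {n : ℕ} (α : Fin n → ℝ) :
    Integrable (fun y => ∑ i, α i * y i) (expPi n) ∧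
      ∫ y, ∑ i, α i * y i ∂(expPi n) = ∑ i, α i := by
  have hi (i : Fin n) : Integrable (fun y : Fin n → ℝ => y i) (expPi n) :=
    integrable_comp_eval (μ := fun _ : Fin n => expMeasure 1) (i := i) (f := fun y : ℝ => y)
      integrable_id_expMeasure.1
  refine ⟨integrable_finsetSum _ fun i _ => (hi i).const_mul _, ?_⟩
  rw [integral_finsetSum _ fun i _ => (hi i).const_mul _]
  refine Finset.sum_congr rfl fun i _ => ?_
  rw [integral_const_mul, integral_comp_eval (μ := fun _ : Fin n => expMeasure 1) (i := i)
    (f := fun y : ℝ => y) (by fun_prop), integrable_id_expMeasure.2, mul_one]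

lemma ae_pos_expPi (n : ℕ) : ∀ᵐ y ∂(expPi n), ∀ i, 0 < y i := by
  rw [ae_all_iff]
  exact fun i => (measurePreserving_eval (fun _ : Fin n => expMeasure 1) i).quasiMeasurePreserving.ae
    ae_pos_expMeasure

/-- Markov's inequality for the positive part of `∑ αᵢ yᵢ`. -/
lemma measureReal_lt_sum_expPi_le {n : ℕ} (α : Fin n → ℝ) {T : ℝ} (hT : 0 < T) :
    (expPi n).real {y | T ≤ ∑ i, α i * y i} ≤ (∑ i, max (α i) 0) / T := by
  obtain ⟨hint, hmean⟩ := integrable_sum_expPi fun i => max (α i) 0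
  have h := mul_meas_ge_le_integral_of_nonneg (μ := expPi n)
    (f := fun y => ∑ i, max (α i) 0 * y i)
    ((ae_pos_expPi n).mono fun y hy => Finset.sum_nonneg fun i _ =>
      mul_nonneg (le_max_right _ _) (hy i).le) hint T
  rw [hmean] at h
  rw [le_div_iff₀ hT, mul_comm]
  refine (mul_le_mul_of_nonneg_left ?_ hT.le).trans h
  refine ENNReal.toReal_mono (measure_ne_top _ _) (measure_mono_ae ?_)
  filter_upwards [ae_pos_expPi n] with y hy hyT
  refine le_trans (show T ≤ ∑ i, α i * y i from hyT) (Finset.sum_le_sum fun i _ => ?_)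
  exact mul_le_mul_of_nonneg_right (le_max_left _ _) (hy i).le

lemma expMeasure_Ioo_pos {a b : ℝ} (ha : 0 ≤ a) (hab : a < b) : 0 < expMeasure 1 (Ioo a b) := by
  rw [← lintegral_indicator_one measurableSet_Ioo,
    lintegral_expMeasure (measurable_one.indicator measurableSet_Ioo)]
  have : ∫⁻ y in Ioi 0, (Ioo a b).indicator 1 y * ENNReal.ofReal (Real.exp (-y)) =
      ∫⁻ y in Ioo a b, ENNReal.ofReal (Real.exp (-y)) := by
    rw [← lintegral_indicator measurableSet_Ioi, ← lintegral_indicator measurableSet_Ioo]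
    refine lintegral_congr fun y => ?_
    by_cases hy : y ∈ Ioo a b
    · simp [hy, ha.trans_lt hy.1]
    · simp [hy]
  rw [this, setLIntegral_pos_iff (by fun_prop)]
  have : Function.support (fun y : ℝ => ENNReal.ofReal (Real.exp (-y))) = univ := by
    ext y; simp [Real.exp_pos]
  rw [this, univ_inter, Real.volume_Ioo]
  simpa using hab

/-- A weighted sum of independent exponential variables with some negative weight takes values
below any level with positive probability. -/
lemma measure_lt_pos {n : ℕ} (α : Fin n → ℝ) {j : Fin n} (hj : α j < 0) (t : ℝ) :
    0 < expPi n {y | ∑ i, α i * y i < t} := by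
  classical
  set M := (∑ i, |α i| + |t|) / (-α j) with hM
  have hMnn : 0 ≤ M := div_nonneg (by positivity) (by linarith)
  let lo : Fin n → ℝ := fun i => if i = j then M + 1 else 0
  have hlo (i : Fin n) : 0 ≤ lo i := by simp only [lo]; split_ifs <;> linarith
  refine lt_of_lt_of_le ?_ (measure_mono
    (s := Set.pi univ fun i => Ioo (lo i) (lo i + 1)) ?_)
  · rw [Measure.pi_pi]
    refine pos_iff_ne_zero.2 (Finset.prod_ne_zero_iff.2 fun i _ => ?_)
    exact (expMeasure_Ioo_pos (hlo i) (by linarith)).ne'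
  · intro y hy
    have hy' (i : Fin n) : lo i < y i ∧ y i < lo i + 1 := hy i (mem_univ i)
    have hb (i : Fin n) : α i * y i ≤ |α i| + if i = j then α j * (M + 1) else 0 := by
      obtain ⟨h1, h2⟩ := hy' i
      by_cases hi : i = j
      · subst hi
        simp only [lo, if_true] at h1 ⊢
        nlinarith [abs_nonneg (α i)]
      · simp only [lo, hi, if_false] at h1 h2 ⊢
        nlinarith [le_abs_self (α i), abs_nonneg (α i)]
    have hsum := Finset.sum_le_sum fun i (_ : i ∈ Finset.univ) => hb i
    rw [Finset.sum_add_distrib, Finset.sum_ite_eq' Finset.univ j] at hsum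
    have hMj : α j * M = -(∑ i, |α i| + |t|) := by
      rw [hM]; field_simp [hj.ne]
    simp only [Finset.mem_univ, if_true] at hsum
    show ∑ i, α i * y i < t
    linarith [neg_abs_le t]

lemma log_add_log_le {g : ℝ → ℝ≥0∞} (hg : IsLogConcave g) (hpos : ∀ t, 0 < g t)
    (hfin : ∀ t, g t ≠ ∞) ⦃p q r s : ℝ⦄ (hpq : p ≤ q) (hpr : p ≤ r) (h : p + s = q + r) :
    Real.log (g p).toReal + Real.log (g s).toReal ≤
      Real.log (g q).toReal + Real.log (g r).toReal := by
  have hp (t : ℝ) : 0 < (g t).toReal := ENNReal.toReal_pos (hpos t).ne' (hfin t)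
  rw [← Real.log_mul (hp p).ne' (hp s).ne', ← Real.log_mul (hp q).ne' (hp r).ne']
  refine Real.log_le_log (mul_pos (hp p) (hp s)) ?_
  rw [← ENNReal.toReal_mul, ← ENNReal.toReal_mul]
  exact ENNReal.toReal_mono (ENNReal.mul_ne_top (hfin q) (hfin r)) (hg hpq hpr h)

/-- Grünbaum's inequality in one dimension: a log-concave distribution with mean `0` gives mass at
least `1/e` to the negative half-line. If `F` is the distribution function of `Z` and
`F t ≤ F 0 * e^{r t} = e^{-r (t₀ - t)}`, then
`t₀ = E (t₀ - Z) ≤ E (t₀ - Z)⁺ = ∫ F (t₀ - s) ds ≤ 1 / r`, so that `-log (F 0) = r t₀ ≤ 1`. -/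
lemma exp_neg_one_le_measureReal_lt {n : ℕ} (α : Fin n → ℝ) (hsum : ∑ i, α i = 0)
    (hne : α ≠ 0) : Real.exp (-1) ≤ (expPi n).real {y | ∑ i, α i * y i < 0} := by
  obtain ⟨j, hj⟩ : ∃ j, α j < 0 := by
    by_contra! hcon
    exact hne (funext fun i => (Finset.sum_eq_zero_iff_of_nonneg fun i _ => hcon i).1 hsum i
      (Finset.mem_univ i))
  set F : ℝ → ℝ := fun t => (expPi n).real {y | ∑ i, α i * y i < t} with hF
  have hFpos (t : ℝ) : 0 < F t := ENNReal.toReal_pos (measure_lt_pos α hj t).ne' (measure_ne_top _ _)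
  have hFmono : Monotone F := fun s t hst =>
    measureReal_mono (fun y (hy : _ < s) => lt_of_lt_of_le hy hst)
  obtain ⟨r, hr0, hr⟩ := exists_slope_of_monotone (L := fun t => Real.log (F t))
    (fun s t hst => Real.log_le_log (hFpos s) (hFmono hst))
    (log_add_log_le (isLogConcave_measure_lt α) (measure_lt_pos α hj) fun t => measure_ne_top _ _)
  change Real.exp (-1) ≤ F 0
  rw [← Real.le_log_iff_exp_le (hFpos 0)]
  rcases hr0.eq_or_lt with rfl | hrpos
  · -- A zero slope bounds `F` by `F 0` everywhere, and `F (2 S + 1) ≥ 1 / 2` by Markov.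
    set S := ∑ i, max (α i) 0 with hS
    have hSnn : 0 ≤ S := Finset.sum_nonneg fun i _ => le_max_right _ _
    have h1 := measureReal_lt_sum_expPi_le α (T := 2 * S + 1) (by linarith)
    have h2 : F (2 * S + 1) = 1 - (expPi n).real {y | 2 * S + 1 ≤ ∑ i, α i * y i} := by
      rw [← probReal_compl_eq_one_sub (measurableSet_le measurable_const (by fun_prop))]
      simp only [hF]; congr 1; ext y; simp
    have h3 : S / (2 * S + 1) ≤ 1 / 2 := by
      rw [div_le_div_iff₀ (by linarith) two_pos]; linarith
    have h4 : Real.log (1 / 2) ≤ Real.log (F (2 * S + 1)) :=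
      Real.log_le_log (by norm_num) (by linarith)
    have h5 := hr (2 * S + 1)
    rw [one_div, Real.log_inv] at h4
    simp only [zero_mul, add_zero] at h5
    linarith [Real.log_two_lt_d9]
  · set t₀ := -Real.log (F 0) / r with ht₀
    have hrt : r * t₀ = -Real.log (F 0) := by rw [ht₀]; field_simp
    have hF' (s : ℝ) : F (t₀ - s) ≤ Real.exp (-(r * s)) := by
      rw [← Real.log_le_iff_le_exp (hFpos _)]
      have := hr (t₀ - s)
      rw [mul_sub, hrt] at this
      linarith
    obtain ⟨hint, hmean⟩ := integrable_sum_expPi α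
    have hint' : Integrable (fun y => t₀ - ∑ i, α i * y i) (expPi n) :=
      (integrable_const _).sub hint
    have h1 : t₀ = ∫ y, (t₀ - ∑ i, α i * y i) ∂(expPi n) := by
      rw [integral_sub (integrable_const _) hint, hmean, hsum]; simp
    have hposint : Integrable (fun y => max (t₀ - ∑ i, α i * y i) 0) (expPi n) := hint'.pos_part
    have h2 : t₀ ≤ ∫ y, max (t₀ - ∑ i, α i * y i) 0 ∂(expPi n) := by
      conv_lhs => rw [h1]
      exact integral_mono hint' hposint fun y => le_max_left _ _
    have h3 : ENNReal.ofReal t₀ ≤ ENNReal.ofReal (1 / r) := by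
      refine (ENNReal.ofReal_le_ofReal h2).trans ?_
      have hnn : 0 ≤ᵐ[expPi n] fun y => max (t₀ - ∑ i, α i * y i) 0 :=
        Filter.Eventually.of_forall fun y => le_max_right _ _
      have hlayer := lintegral_eq_lintegral_meas_lt (expPi n) hnn hposint.aemeasurable
      rw [ofReal_integral_eq_lintegral_ofReal hposint hnn, hlayer]
      have hI : ∫ s in Ioi (0 : ℝ), Real.exp (-r * s) = 1 / r := by
        rw [integral_exp_mul_Ioi (by linarith)]; simp
      rw [← hI, ofReal_integral_eq_lintegral_ofReal (integrableOn_exp_mul_Ioi (by linarith) 0)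
        (Filter.Eventually.of_forall fun s => (Real.exp_pos _).le)]
      refine setLIntegral_mono (by fun_prop) fun s hs => ?_
      rw [ENNReal.le_ofReal_iff_toReal_le (measure_ne_top _ _) (Real.exp_pos _).le]
      refine le_trans (le_of_eq ?_) ((hF' s).trans (le_of_eq (by ring_nf)))
      simp only [hF, Measure.real]
      congr 2
      ext y
      simp only [mem_ofPred_eq, lt_max_iff, not_lt.2 (le_of_lt (mem_Ioi.1 hs)), or_false]
      constructor <;> intro h <;> linarith
    rw [ENNReal.ofReal_le_ofReal_iff (by positivity), le_div_iff₀ hrpos] at h3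
    linarith

/-- The value `E[e^{-Z}; Z > 0]` for `Z = ∑ αᵢ yᵢ`, `y` having independent standard exponential
coordinates. -/
noncomputable def tiltedMass {n : ℕ} (α : Fin n → ℝ) : ℝ≥0∞ :=
  ∫⁻ y, {y : Fin n → ℝ | 0 < ∑ i, α i * y i}.indicator
    (fun y => ENNReal.ofReal (Real.exp (-∑ i, α i * y i))) y ∂(expPi n)

lemma measurableSet_sum_pos {n : ℕ} (α : Fin n → ℝ) :
    MeasurableSet {y : Fin n → ℝ | 0 < ∑ i, α i * y i} :=
  measurableSet_lt measurable_const (by fun_prop)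

lemma tiltedMass_le_measure {n : ℕ} (α : Fin n → ℝ) :
    tiltedMass α ≤ expPi n {y | 0 < ∑ i, α i * y i} := by
  rw [← lintegral_indicator_one (measurableSet_sum_pos α)]
  refine lintegral_mono fun y => ?_
  by_cases hy : 0 < ∑ i, α i * y i
  · simp [indicator, hy, hy.le]
  · simp [indicator, hy]

lemma le_tiltedMass {n : ℕ} (α : Fin n → ℝ) :
    ENNReal.ofReal (Real.exp (-1)) * expPi n {y | 0 < ∑ i, α i * y i ∧ ∑ i, α i * y i ≤ 1} ≤
      tiltedMass α := by
  have hm : MeasurableSet {y : Fin n → ℝ | 0 < ∑ i, α i * y i ∧ ∑ i, α i * y i ≤ 1} :=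
    (measurableSet_sum_pos α).inter
      (measurableSet_le (Finset.measurable_sum _ fun i _ => (measurable_pi_apply i).const_mul _)
        measurable_const)
  rw [← lintegral_indicator_one hm,
    ← lintegral_const_mul _ (measurable_one.indicator hm)]
  refine lintegral_mono fun y => ?_
  by_cases hy : 0 < ∑ i, α i * y i ∧ ∑ i, α i * y i ≤ 1
  · simp only [indicator, mem_ofPred_eq, hy, and_self, if_true, Pi.one_apply, mul_one]
    exact ENNReal.ofReal_le_ofReal (Real.exp_le_exp.2 (by linarith [hy.2]))
  · simp [indicator, hy]

/-- The numerical inequality behind the constant `1 / (2 e ^ 3)`, with `E = e⁻¹`, `x = 1 / d`, and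
`q`, `G` the values at `0` and `4 d` of a distribution function. The expression `q (1 - q / G)` is
concave in `q`, so that only the ends of the range of `q` matter. -/
lemma quadratic_bound {q G x E : ℝ} (hE : E ≤ 0.368) (hE' : 0.3678 ≤ E) (hq : E ≤ q)
    (hq' : q ≤ 1 - E) (hx : 0 < x) (hx' : x ≤ 1 / 2) (hG : 3 / 4 + x / 4 ≤ G) :
    2 * E ^ 2 * x ≤ q * (1 - q / G) := by
  have hG0 : 0 < G := by linarith
  have h1 : q / G ≤ q / (3 / 4 + x / 4) := by
    gcongr
    linarith
  have hq0 : 0 < q := by linarith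
  have h2 : q * (1 - q / (3 / 4 + x / 4)) ≤ q * (1 - q / G) := by gcongr
  refine le_trans ?_ h2
  have hE2 : E ^ 2 ≤ 0.1355 := by nlinarith
  have h3 : 2 * E ^ 2 * x ≤ 0.271 * x := by nlinarith
  refine h3.trans ?_
  have h4 : q * (1 - q / (3 / 4 + x / 4)) = q * (3 / 4 + x / 4 - q) / (3 / 4 + x / 4) := by
    field_simp
  rw [h4, le_div_iff₀ (by linarith)]
  have h5 : 0 ≤ (q - 0.3678) * (0.6322 - q) := mul_nonneg (by linarith) (by linarith)
  nlinarith

/-- The key lower bound. With `F` the distribution function of `Z = ∑ αᵢ yᵢ`, both `F 0` and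
`1 - F 0` are at least `1/e`, while `F (4 d)` is at least `3/4`; as `F (k) / F 0 ≤ (F 1 / F 0) ^ k`,
the ratio `F 1 / F 0` exceeds `1` by a multiple of `1 / d`, so `0 < Z ≤ 1` is likely enough. -/
lemma le_tiltedMass_of_sum_eq_zero {d : ℕ} (α : Fin d → ℝ) (hsum : ∑ i, α i = 0) (hne : α ≠ 0)
    (hα : ∀ i, -1 ≤ α i) :
    ENNReal.ofReal (1 / (2 * Real.exp 1 ^ 3) / (d : ℝ) ^ 2) ≤ tiltedMass α := by
  obtain ⟨j, hj⟩ : ∃ j, 0 < α j := by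
    by_contra! hcon
    exact hne (funext fun i => (Finset.sum_eq_zero_iff_of_nonpos fun i _ => hcon i).1 hsum i
      (Finset.mem_univ i))
  have hd : 2 ≤ d := by
    by_contra! hlt
    interval_cases d
    · exact j.elim0
    · rw [Fin.sum_univ_one] at hsum
      rw [Subsingleton.elim j 0] at hj
      linarith
  have hd' : (2 : ℝ) ≤ d := by exact_mod_cast hd
  -- the positive part of `α` has total weight at most `d - 1`
  have hS : ∑ i, max (α i) 0 ≤ d - 1 := by
    have h1 (i : Fin d) : max (α i) 0 ≤ α i + if i = j then 0 else 1 := by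
      by_cases hi : i = j
      · subst hi; simp [hj.le]
      · simp only [hi, if_false]
        exact max_le (by linarith) (by linarith [hα i])
    refine (Finset.sum_le_sum fun i _ => h1 i).trans (le_of_eq ?_)
    rw [Finset.sum_add_distrib, hsum, zero_add]
    have h2 : ∀ i : Fin d, (if i = j then (0 : ℝ) else 1) = 1 - if i = j then 1 else 0 := by
      intro i; split_ifs <;> simp
    simp [h2]
  set F : ℝ → ℝ := fun t => (expPi d).real {y | ∑ i, α i * y i ≤ t} with hF
  have hq : Real.exp (-1) ≤ F 0 := (exp_neg_one_le_measureReal_lt α hsum hne).trans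
    (measureReal_mono fun y (hy : _ < (0 : ℝ)) => le_of_lt hy)
  have hq' : F 0 ≤ 1 - Real.exp (-1) := by
    have h := exp_neg_one_le_measureReal_lt (fun i => -α i) (by simp [hsum])
      (fun h => hne (funext fun i => by simpa using congrFun h i))
    have h2 : F 0 = 1 - (expPi d).real {y | ∑ i, -α i * y i < 0} := by
      rw [← probReal_compl_eq_one_sub (measurableSet_lt (by fun_prop) measurable_const)]
      simp only [hF]; congr 1; ext y; simp
    linarith
  have hF0 : 0 < F 0 := (Real.exp_pos _).trans_le hq
  have hmono : Monotone F := fun s t hst =>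
    measureReal_mono (fun y (hy : _ ≤ s) => le_trans hy hst)
  have hT : 3 / 4 + 1 / (d : ℝ) / 4 ≤ F (4 * d) := by
    have h1 := measureReal_lt_sum_expPi_le α (T := 4 * d) (by positivity)
    have h2 : 1 - (expPi d).real {y | 4 * (d : ℝ) ≤ ∑ i, α i * y i} ≤ F (4 * d) := by
      rw [← probReal_compl_eq_one_sub (measurableSet_le measurable_const (by fun_prop))]
      exact measureReal_mono fun y hy => le_of_lt (by simpa using hy)
    have h3 : (∑ i, max (α i) 0) / (4 * d) ≤ (d - 1) / (4 * d) := by gcongr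
    have h4 : ((d : ℝ) - 1) / (4 * d) = 1 / 4 - 1 / (d : ℝ) / 4 := by field_simp
    linarith
  -- By log-concavity, `F k / F 0` grows at most geometrically in `k`.
  set ρ := F 1 / F 0 with hρ
  have hρ1 : 1 ≤ ρ := (one_le_div hF0).2 (hmono zero_le_one)
  have hgeo (k : ℕ) : F k ≤ F 0 * ρ ^ k := by
    induction k with
    | zero => simp
    | succ k ih =>
      have h1 : F 0 * F (k + 1) ≤ F k * F 1 := by
        simp only [hF, Measure.real, ← ENNReal.toReal_mul]
        exact ENNReal.toReal_mono (ENNReal.mul_ne_top (measure_ne_top _ _) (measure_ne_top _ _))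
          (isLogConcave_measure_le α k.cast_nonneg zero_le_one (by ring))
      have h2 : F 0 * F (k + 1) ≤ F 0 * (F 0 * ρ ^ (k + 1)) := by
        calc F 0 * F (k + 1) ≤ F k * F 1 := h1
          _ ≤ F 0 * ρ ^ k * F 1 := by gcongr
          _ = F 0 * ρ ^ k * (F 0 * ρ) := by rw [hρ, mul_div_cancel₀ _ hF0.ne']
          _ = _ := by ring
      push_cast
      exact le_of_mul_le_mul_left h2 hF0
  have hG0 : 0 < F (4 * d) := lt_of_lt_of_le (by positivity) hT
  have hlog : 1 - F 0 / F (4 * d) ≤ 4 * d * (ρ - 1) := by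
    have h1 : F (4 * d) ≤ F 0 * ρ ^ (4 * d) := by simpa using hgeo (4 * d)
    have h2 := Real.one_sub_inv_le_log_of_pos (div_pos hG0 hF0)
    rw [inv_div] at h2
    have h3 : Real.log (F (4 * d) / F 0) ≤ Real.log (ρ ^ (4 * d)) :=
      Real.log_le_log (div_pos hG0 hF0) ((div_le_iff₀' hF0).2 h1)
    rw [Real.log_pow] at h3
    have h4 := Real.log_le_sub_one_of_pos (zero_lt_one.trans_le hρ1)
    push_cast at h3
    have h5 : 4 * (d : ℝ) * Real.log ρ ≤ 4 * d * (ρ - 1) := by gcongr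
    linarith
  have he : Real.exp (-1) = 1 / Real.exp 1 := by rw [Real.exp_neg, one_div]
  have hnum := quadratic_bound (x := 1 / (d : ℝ)) (Real.exp_neg_one_lt_d9.le.trans (by norm_num))
    (le_trans (by norm_num) Real.exp_neg_one_gt_d9.le) hq hq' (by positivity)
    (one_div_le_one_div_of_le two_pos hd') hT
  have hdiff : 2 * Real.exp (-1) ^ 2 * (1 / (d : ℝ)) ≤ 4 * d * (F 1 - F 0) := by
    calc _ ≤ F 0 * (1 - F 0 / F (4 * d)) := hnum
      _ ≤ F 0 * (4 * d * (ρ - 1)) := by gcongr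
      _ = _ := by rw [hρ]; field_simp
  refine le_trans ?_ (le_tiltedMass α)
  have hset : F 1 - F 0 =
      (expPi d).real {y | 0 < ∑ i, α i * y i ∧ ∑ i, α i * y i ≤ 1} := by
    have hsub : {y : Fin d → ℝ | ∑ i, α i * y i ≤ 0} ⊆ {y | ∑ i, α i * y i ≤ 1} :=
      fun y (hy : _ ≤ (0 : ℝ)) => le_trans hy zero_le_one
    simp only [hF]
    rw [← measureReal_sdiff hsub (measurableSet_le (by fun_prop) measurable_const)]
    congr 1
    ext y
    simp [and_comm]
  rw [← ofReal_measureReal, ← hset, ← ENNReal.ofReal_mul (Real.exp_pos _).le]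
  refine ENNReal.ofReal_le_ofReal ?_
  rw [he] at hdiff ⊢
  have h6 : 2 * (1 / Real.exp 1) ^ 2 * (1 / (d : ℝ)) / (4 * d) ≤ F 1 - F 0 := by
    rw [div_le_iff₀ (by positivity)]; linarith
  refine le_trans (le_of_eq ?_) (mul_le_mul_of_nonneg_left h6 (by positivity))
  field_simp
  norm_num

/-! ### Polar decomposition along the simplex -/

lemma mem_direction_iff {d : ℕ} (hd : 0 < d) (v : EuclideanSpace ℝ (Fin d)) :
    v ∈ (ambient d).direction ↔ ∑ i, v i = 0 := by
  have hc : center d ∈ ambient d := by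
    show ∑ i, (center d) i = 1
    have : (d : ℝ) ≠ 0 := by positivity
    simp [center, this]
  have hc' : ∑ i, (center d) i = 1 := hc
  rw [← AffineSubspace.vadd_mem_iff_mem_direction _ hc]
  show ∑ i, (v + center d) i = 1 ↔ _
  simp [Finset.sum_add_distrib, hc']

lemma sum_center {d : ℕ} (hd : 0 < d) : ∑ i, (center d) i = 1 := by
  have : (d : ℝ) ≠ 0 := by positivity
  simp [center, this]

/-- The coordinates `x = v + t c`, with `v` parallel to the hyperplane and `t = ∑ xᵢ`. -/
noncomputable def coneCoords (d : ℕ) :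
    (ambient d).direction × ℝ →ₗ[ℝ] (Fin d → ℝ) :=
  (WithLp.linearEquiv 2 ℝ (Fin d → ℝ)).toLinearMap ∘ₗ
    ((ambient d).direction.subtype.coprod (LinearMap.toSpanSingleton ℝ _ (center d)))

lemma coneCoords_apply {d : ℕ} (p : (ambient d).direction × ℝ) (i : Fin d) :
    coneCoords d p i = (p.1 : EuclideanSpace ℝ (Fin d)) i + p.2 * center d i := by
  simp [coneCoords]

lemma sum_coneCoords {d : ℕ} (hd : 0 < d) (v : (ambient d).direction) (t : ℝ) :
    ∑ i, coneCoords d (v, t) i = t := by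
  simp only [coneCoords_apply]
  rw [Finset.sum_add_distrib, ← Finset.mul_sum, sum_center hd,
    (mem_direction_iff hd _).1 v.2]
  simp

lemma coneCoords_bijective {d : ℕ} (hd : 0 < d) : Function.Bijective (coneCoords d) := by
  constructor
  · rw [injective_iff_map_eq_zero]
    rintro ⟨v, t⟩ h
    have ht : t = 0 := by
      have := sum_coneCoords hd v t
      rw [h] at this
      simpa using this.symm
    subst ht
    have hv : v = 0 := by
      ext i
      simpa [coneCoords_apply] using congrFun h i
    rw [hv]; rfl
  · intro x
    refine ⟨⟨⟨WithLp.toLp 2 x - (∑ i, x i) • center d, ?_⟩, ∑ i, x i⟩, ?_⟩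
    · rw [mem_direction_iff hd]
      simp [Finset.sum_sub_distrib, ← Finset.mul_sum, sum_center hd]
    · ext i
      simp [coneCoords_apply]

instance (d : ℕ) : (directionVolume d).IsAddHaarMeasure := by
  unfold directionVolume; infer_instance

/-- Lebesgue measure in the coordinates `x = v + t c`, by uniqueness of Haar measure. The value of
the constant plays no role, since only ratios of volumes are needed. -/
lemma exists_volume_eq_smul_map {d : ℕ} (hd : 0 < d) :
    ∃ k : ℝ≥0∞, (volume : Measure (Fin d → ℝ)) =
      k • ((directionVolume d).prod volume).map (coneCoords d) := by
  let e := (LinearEquiv.ofBijective (coneCoords d) (coneCoords_bijective hd)).toContinuousLinearEquiv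
  have he : (coneCoords d : (ambient d).direction × ℝ → Fin d → ℝ) = e := rfl
  have : (((directionVolume d).prod volume).map e).IsAddHaarMeasure :=
    e.isAddHaarMeasure_map _
  rw [he]
  exact ⟨_, Measure.isAddLeftInvariant_eq_smul _ _⟩

lemma lintegral_expPi {d : ℕ} {f : (Fin d → ℝ) → ℝ≥0∞} (hf : Measurable f) :
    ∫⁻ y, f y ∂(expPi d) =
      ∫⁻ y, f y * ∏ i, (Ioi 0).indicator (fun s => ENNReal.ofReal (Real.exp (-s))) (y i) := by
  have hm : Measurable ((Ioi (0 : ℝ)).indicator (fun s => ENNReal.ofReal (Real.exp (-s)))) :=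
    Measurable.indicator (by fun_prop) measurableSet_Ioi
  refine lintegral_pi_change (fun _ => expMeasure 1) (fun _ => volume) (fun _ => id)
    (fun _ => (Ioi 0).indicator (fun s => ENNReal.ofReal (Real.exp (-s)))) (fun _ => measurable_id)
    (fun _ => hm) (fun _ g hg => ?_) hf
  rw [lintegral_expMeasure hg, ← lintegral_indicator measurableSet_Ioi]
  refine lintegral_congr fun y => ?_
  by_cases hy : y ∈ Ioi (0 : ℝ) <;> simp [hy]

lemma prod_indicator_exp {d : ℕ} (y : Fin d → ℝ) :
    ∏ i, (Ioi 0).indicator (fun s => ENNReal.ofReal (Real.exp (-s))) (y i) =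
      {y : Fin d → ℝ | ∀ i, 0 < y i}.indicator
        (fun y => ENNReal.ofReal (Real.exp (-∑ i, y i))) y := by
  by_cases hy : ∀ i, 0 < y i
  · rw [indicator_of_mem (by exact hy), ← Finset.sum_neg_distrib, Real.exp_sum,
      ENNReal.ofReal_prod_of_nonneg fun i _ => (Real.exp_pos _).le]
    exact Finset.prod_congr rfl fun i _ => indicator_of_mem (hy i) _
  · rw [indicator_of_notMem (by exact hy)]
    push Not at hy
    obtain ⟨i, hi⟩ := hy
    exact Finset.prod_eq_zero (Finset.mem_univ i) (indicator_of_notMem (by simpa using hi) _)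

/-- The exponential law of a cone is proportional to the volume of its section by the simplex: the
density `e^{-∑ xᵢ}` depends only on the height `t = ∑ xᵢ`, and the section at height `t` is the
section at height `1` scaled by `t`. -/
lemma exists_expPi_cone_eq {d : ℕ} (hd : 0 < d) :
    ∃ k : ℝ≥0∞, ∀ C : Set (Fin d → ℝ), MeasurableSet C →
      (∀ t : ℝ, 0 < t → ∀ x, t • x ∈ C ↔ x ∈ C) →
      expPi d C = k * directionVolume d
        {v | center d + (v : EuclideanSpace ℝ (Fin d)) ∈ simplex d ∩ {x | WithLp.ofLp x ∈ C}} := by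
  obtain ⟨k, hk⟩ := exists_volume_eq_smul_map hd
  set N := Module.finrank ℝ (ambient d).direction
  refine ⟨k * ∫⁻ t in Ioi (0 : ℝ), ENNReal.ofReal (t ^ N) * ENNReal.ofReal (Real.exp (-t)),
    fun C hC hcone => ?_⟩
  set P : Set (Fin d → ℝ) := C ∩ {y | ∀ i, 0 < y i} with hP
  have hPm : MeasurableSet P := by
    refine hC.inter ?_
    simp only [ofPred_forall]
    exact MeasurableSet.iInter fun i => measurableSet_lt measurable_const (measurable_pi_apply i)
  have hPcone (t : ℝ) (ht : 0 < t) (x) : t • x ∈ P ↔ x ∈ P := by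
    simp [hP, hcone t ht, mul_pos_iff_of_pos_left ht]
  have hLm : Measurable (coneCoords d) := (coneCoords d).continuous_of_finiteDimensional.measurable
  set g : (Fin d → ℝ) → ℝ≥0∞ := P.indicator fun y => ENNReal.ofReal (Real.exp (-∑ i, y i)) with hg
  have hgm : Measurable g := Measurable.indicator (by fun_prop) hPm
  set B : Set (ambient d).direction := {v | coneCoords d (v, 1) ∈ P} with hB
  have hBeq : B = {v : (ambient d).direction | center d + (v : EuclideanSpace ℝ (Fin d)) ∈
      simplex d ∩ {x | WithLp.ofLp x ∈ C}} := by
    ext v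
    have h1 : coneCoords d (v, 1) = WithLp.ofLp (center d + (v : EuclideanSpace ℝ (Fin d))) := by
      ext i; simp [coneCoords_apply, add_comm]
    have h2 : center d + (v : EuclideanSpace ℝ (Fin d)) ∈ ambient d := by
      show ∑ i, (center d + (v : EuclideanSpace ℝ (Fin d))) i = 1
      rw [← sum_coneCoords hd v 1, h1]
    simp only [hB, hP, h1, simplex, mem_ofPred_eq, mem_inter_iff, h2, true_and]
    exact and_comm
  rw [← hBeq]
  have h1 : expPi d C = ∫⁻ y, g y := by
    rw [← lintegral_indicator_one hC, lintegral_expPi (measurable_one.indicator hC)]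
    refine lintegral_congr fun y => ?_
    rw [prod_indicator_exp, hg, hP]
    by_cases hy : y ∈ C <;> simp [indicator, hy]
  have hslice (t : ℝ) : ∫⁻ v, g (coneCoords d (v, t)) ∂(directionVolume d) =
      (Ioi (0 : ℝ)).indicator (fun t => ENNReal.ofReal (t ^ N) * ENNReal.ofReal (Real.exp (-t))) t *
        directionVolume d B := by
    by_cases ht : 0 < t
    · have hpre : {v : (ambient d).direction | coneCoords d (v, t) ∈ P} = (fun v => t⁻¹ • v) ⁻¹' B := by
        ext v
        have : coneCoords d (v, t) = t • coneCoords d (t⁻¹ • v, 1) := by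
          rw [← map_smul]; simp [smul_smul, ht.ne']
        simp only [mem_ofPred_eq, this, hPcone t ht, mem_preimage, hB]
      have hgt (v : (ambient d).direction) : g (coneCoords d (v, t)) =
          {v : (ambient d).direction | coneCoords d (v, t) ∈ P}.indicator
            (fun _ => ENNReal.ofReal (Real.exp (-t))) v := by
        simp only [hg, indicator, sum_coneCoords hd]
        rfl
      have hm : MeasurableSet {v : (ambient d).direction | coneCoords d (v, t) ∈ P} :=
        (hLm.comp (measurable_id.prodMk measurable_const)) hPm
      simp only [hgt]
      rw [lintegral_indicator_const hm, hpre, Measure.addHaar_preimage_smul _ (inv_ne_zero ht.ne'),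
        indicator_of_mem (by exact ht), inv_pow, inv_inv, abs_of_pos (by positivity)]
      ring
    · rw [indicator_of_notMem (by simpa using ht), zero_mul]
      refine (lintegral_congr fun v => ?_).trans lintegral_zero
      refine indicator_of_notMem (fun hv => ht ?_) _
      rw [← sum_coneCoords hd v t]
      have : Nonempty (Fin d) := ⟨⟨0, hd⟩⟩
      exact Finset.sum_pos (fun i _ => hv.2 i) Finset.univ_nonempty
  have hgL : Measurable fun p => g (coneCoords d p) := hgm.comp hLm
  have hwt : Measurable ((Ioi (0 : ℝ)).indicator
      (fun t => ENNReal.ofReal (t ^ N) * ENNReal.ofReal (Real.exp (-t)))) :=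
    Measurable.indicator (by fun_prop) measurableSet_Ioi
  rw [h1, hk, lintegral_smul_measure, lintegral_map hgm hLm, lintegral_prod_symm' _ hgL]
  simp only [hslice, smul_eq_mul]
  rw [lintegral_mul_const _ hwt, lintegral_indicator measurableSet_Ioi, mul_assoc]

/-- The share of the simplex cut out by a cone is the probability that a vector of independent
standard exponential variables lies in it. -/
lemma vol_inter_cone_div_vol {d : ℕ} (hd : 0 < d) {C : Set (Fin d → ℝ)} (hC : MeasurableSet C)
    (hcone : ∀ t : ℝ, 0 < t → ∀ x, t • x ∈ C ↔ x ∈ C) :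
    vol d (simplex d ∩ {x | WithLp.ofLp x ∈ C}) / vol d (simplex d) = (expPi d).real C := by
  obtain ⟨k, hk⟩ := exists_expPi_cone_eq hd
  have h1 := hk univ MeasurableSet.univ (by simp)
  simp only [measure_univ, mem_univ, ofPred_true, inter_univ] at h1
  have h2 := hk C hC hcone
  have h1' := congrArg ENNReal.toReal h1
  have h2' := congrArg ENNReal.toReal h2
  rw [ENNReal.toReal_mul] at h1' h2'
  change (expPi d).real C = _ * vol d _ at h2'
  change _ = _ * vol d _ at h1'
  rw [ENNReal.toReal_one] at h1'
  have hv : vol d (simplex d) ≠ 0 := fun h => by simp [h] at h1'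
  rw [h2', div_eq_iff hv]
  linear_combination vol d (simplex d ∩ {x | WithLp.ofLp x ∈ C}) * h1'

/-! ### The maximum point and the proof of the estimate -/

/-- The substitution `xᵢ = bᵢ yᵢ` turns the density `∏ e^{-xᵢ}` into `∏ bᵢ * e^{-Z} * ∏ e^{-yᵢ}` and
the cone into `Z > 0`, for `Z = ∑ (bᵢ - 1) yᵢ`. -/
lemma expPi_cone_eq_prod_mul_tiltedMass {d : ℕ} {b : Fin d → ℝ} (hb : ∀ i, 0 < b i) :
    expPi d {x | ∑ i, (1 / b i - 1) * x i < 0} =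
      ENNReal.ofReal (∏ i, b i) * tiltedMass fun i => b i - 1 := by
  have hm : MeasurableSet {x : Fin d → ℝ | ∑ i, (1 / b i - 1) * x i < 0} :=
    measurableSet_lt (by fun_prop) measurable_const
  rw [← lintegral_indicator_one hm,
    lintegral_pi_change (fun _ => expMeasure 1) (fun _ => expMeasure 1) (fun i y => b i * y)
      (fun i y => ENNReal.ofReal (b i * Real.exp ((1 - b i) * y))) (fun i => by fun_prop)
      (fun i => by fun_prop) (fun i f hf => lintegral_expMeasure_tilt (hb i) hf)
      (measurable_one.indicator hm), tiltedMass,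
    ← lintegral_const_mul _ (Measurable.indicator (by fun_prop) (measurableSet_sum_pos _))]
  refine lintegral_congr fun y => ?_
  have h1 : ∑ i, (1 / b i - 1) * (b i * y i) = -∑ i, (b i - 1) * y i := by
    rw [← Finset.sum_neg_distrib]
    refine Finset.sum_congr rfl fun i _ => ?_
    have := (hb i).ne'
    field_simp
    ring
  have h2 : ∏ i, ENNReal.ofReal (b i * Real.exp ((1 - b i) * y i)) =
      ENNReal.ofReal (∏ i, b i) * ENNReal.ofReal (Real.exp (-∑ i, (b i - 1) * y i)) := by
    rw [← ENNReal.ofReal_prod_of_nonneg fun i _ => by have := hb i; positivity,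
      Finset.prod_mul_distrib, ENNReal.ofReal_mul (Finset.prod_nonneg fun i _ => (hb i).le),
      ← Real.exp_sum, ← Finset.sum_neg_distrib]
    congr 4
    ext i
    ring
  rw [h2]
  simp only [indicator, mem_ofPred_eq, h1, Left.neg_neg_iff]
  split_ifs <;> simp

lemma inner_eq_sum {d : ℕ} (u x : EuclideanSpace ℝ (Fin d)) :
    inner ℝ u x = ∑ i, u i * x i := by
  rw [PiLp.inner_apply]
  exact Finset.sum_congr rfl fun i _ => by simp [mul_comm]

/-- First-order condition: the derivative of `logSum` at a maximum vanishes along the section. -/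
lemma sum_div_eq_zero_of_isMaxOn {d : ℕ} {u : EuclideanSpace ℝ (Fin d)} {b : ℝ}
    {a : EuclideanSpace ℝ (Fin d)} (ha : a ∈ simplex d) (hab : inner ℝ u a = b)
    (hmax : IsMaxOn (logSum d) (simplex d ∩ {x | x ∈ ambient d ∧ inner ℝ u x = b}) a)
    {v : EuclideanSpace ℝ (Fin d)} (hv : ∑ i, v i = 0) (huv : inner ℝ u v = 0) :
    ∑ i, v i / a i = 0 := by
  have hloc : IsLocalMax (fun t : ℝ => logSum d (a + t • v)) 0 := by
    have hpos : ∀ᶠ t : ℝ in nhds 0, ∀ i, 0 < a i + t * v i := by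
      rw [Filter.eventually_all]
      intro i
      have hc : ContinuousAt (fun t : ℝ => a i + t * v i) 0 := by fun_prop
      exact hc.eventually_const_lt (by simpa using ha.2 i)
    filter_upwards [hpos] with t ht
    have hA : a + t • v ∈ ambient d := by
      show ∑ i, (a + t • v) i = 1
      have h1 : ∑ i, a i = 1 := ha.1
      simp [Finset.sum_add_distrib, ← Finset.mul_sum, hv, h1]
    have := hmax ⟨⟨hA, fun i => by simpa using ht i⟩, hA, by
      rw [inner_add_right, inner_smul_right, huv, hab]; simp⟩
    simpa using this
  refine hloc.hasDerivAt_eq_zero ?_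
  have : ∀ i ∈ Finset.univ, HasDerivAt (fun t : ℝ => Real.log (a i + t * v i)) (v i / a i) 0 := by
    intro i _
    have h1 : HasDerivAt (fun t : ℝ => a i + t * v i) (v i) 0 := by
      simpa using ((hasDerivAt_id (0 : ℝ)).mul_const (v i)).const_add (a i)
    simpa using h1.log (by simpa using (ha.2 i).ne')
  simpa [logSum] using HasDerivAt.fun_sum this

/-- Lagrange multipliers: at a maximum, the gradient `(1 / aᵢ)` of `logSum` is a combination of the
normal `u` and the all-ones vector. -/
lemma exists_one_div_eq_of_isMaxOn {d : ℕ} {u : EuclideanSpace ℝ (Fin d)} {b : ℝ}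
    {a : EuclideanSpace ℝ (Fin d)} (ha : a ∈ simplex d) (hab : inner ℝ u a = b)
    (hmax : IsMaxOn (logSum d) (simplex d ∩ {x | x ∈ ambient d ∧ inner ℝ u x = b}) a) :
    ∃ l m : ℝ, ∀ i, 1 / a i = l * u i + m := by
  let e : EuclideanSpace ℝ (Fin d) := WithLp.toLp 2 fun _ => 1
  let g : EuclideanSpace ℝ (Fin d) := WithLp.toLp 2 fun i => 1 / a i
  have hg : g ∈ (Submodule.span ℝ {u, e})ᗮᗮ := by
    rw [Submodule.mem_orthogonal]
    intro v hv
    rw [Submodule.mem_orthogonal] at hv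
    have hu := hv u (Submodule.subset_span (by simp))
    have he := hv e (Submodule.subset_span (by simp))
    rw [inner_eq_sum] at he ⊢
    have := sum_div_eq_zero_of_isMaxOn ha hab hmax (by simpa [e] using he) hu
    simpa [g, div_eq_mul_inv] using this
  rw [Submodule.orthogonal_orthogonal, Submodule.mem_span_pair] at hg
  obtain ⟨l, m, h⟩ := hg
  refine ⟨l, m, fun i => ?_⟩
  have := congrArg (fun x : EuclideanSpace ℝ (Fin d) => x i) h
  simpa [g, e] using this.symm

/-- Equality in the inequality between the arithmetic and harmonic means. -/
lemma eq_center_of_sum_one_div_le {d : ℕ} {a : Fin d → ℝ} (ha : ∀ i, 0 < a i)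
    (hsum : ∑ i, a i = 1) (h : ∑ i, 1 / a i ≤ (d : ℝ) ^ 2) (i : Fin d) : d * a i = 1 := by
  have h1 : ∑ i, (d * a i - 1) ^ 2 / a i = ∑ i, 1 / a i - (d : ℝ) ^ 2 := by
    have (i : Fin d) : (d * a i - 1) ^ 2 / a i = 1 / a i + ((d : ℝ) ^ 2 * a i - 2 * d) := by
      have := (ha i).ne'
      field_simp
      ring
    simp only [this, Finset.sum_add_distrib, Finset.sum_sub_distrib, ← Finset.mul_sum, hsum]
    simp
    ring
  have hnn (i : Fin d) : 0 ≤ (d * a i - 1) ^ 2 / a i := div_nonneg (sq_nonneg _) (ha i).le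
  have h2 := (Finset.sum_eq_zero_iff_of_nonneg fun i _ => hnn i).1
    (le_antisymm (by linarith) (Finset.sum_nonneg fun i _ => hnn i)) i (Finset.mem_univ i)
  have h3 : (d * a i - 1) ^ 2 = 0 := by
    rcases div_eq_zero_iff.1 h2 with h | h
    · exact h
    · exact absurd h (ha i).ne'
  nlinarith [pow_eq_zero_iff (two_ne_zero) |>.1 h3]

lemma pow_mul_exp_logSum {d : ℕ} {a : EuclideanSpace ℝ (Fin d)} (ha : ∀ i, 0 < a i) :
    (d : ℝ) ^ d * Real.exp (logSum d a) = ∏ i, d * a i := by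
  rw [logSum, Real.exp_sum, Finset.prod_mul_distrib]
  simp [Real.exp_log (ha _)]

lemma vol_inter_halfspace_div_vol {d : ℕ} (hd : 0 < d) {u : EuclideanSpace ℝ (Fin d)} {b : ℝ}
    (w : Fin d → ℝ) (hw : ∀ x ∈ ambient d, inner ℝ u x < b ↔ ∑ i, w i * x i < 0) :
    vol d (simplex d ∩ {x | x ∈ ambient d ∧ inner ℝ u x < b}) / vol d (simplex d) =
      (expPi d).real {x | ∑ i, w i * x i < 0} := by
  have h := vol_inter_cone_div_vol hd (C := {x : Fin d → ℝ | ∑ i, w i * x i < 0})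
    (measurableSet_lt (by fun_prop) measurable_const) fun t ht x => by
      have : ∑ i, w i * (t * x i) = t * ∑ i, w i * x i := by
        rw [Finset.mul_sum]; exact Finset.sum_congr rfl fun i _ => by ring
      simp [this, mul_neg_iff, ht, ht.not_gt]
  rw [← h]
  congr 2
  ext x
  refine and_congr_right fun hx => ?_
  exact ⟨fun h => (hw x hx.1).1 h.2, fun h => ⟨hx.1, (hw x hx.1).2 h⟩⟩

end SimplexSection

open SimplexSection in
theorem theorem3p2 (d : ℕ)
    (H : AffineSubspace ℝ (EuclideanSpace ℝ (Fin d)))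
    (hH : SimplexSection.IsHyperplane d H)
    (hmeet : (SimplexSection.simplex d ∩ (H : Set (EuclideanSpace ℝ (Fin d)))).Nonempty)
    (Hminus : Set (EuclideanSpace ℝ (Fin d)))
    (hHminus : SimplexSection.IsOpenHalfspace d H Hminus)
    (hcenter : SimplexSection.center d ∉ Hminus)
    (a : EuclideanSpace ℝ (Fin d))
    (ha : a ∈ SimplexSection.simplex d ∩ (H : Set (EuclideanSpace ℝ (Fin d))))
    (hmax : IsMaxOn (SimplexSection.logSum d)
      (SimplexSection.simplex d ∩ (H : Set (EuclideanSpace ℝ (Fin d)))) a) :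
    SimplexSection.vol d (SimplexSection.simplex d ∩ Hminus) /
        SimplexSection.vol d (SimplexSection.simplex d) ≤
      (d : ℝ) ^ d * Real.exp (SimplexSection.logSum d a) ∧
    1 / (2 * Real.exp 1 ^ 3) / (d : ℝ) ^ 2 *
        ((d : ℝ) ^ d * Real.exp (SimplexSection.logSum d a)) ≤
      SimplexSection.vol d (SimplexSection.simplex d ∩ Hminus) /
        SimplexSection.vol d (SimplexSection.simplex d) := by
  obtain ⟨u, b, hHeq, rfl⟩ := hHminus
  obtain ⟨haΔ, haH⟩ := ha
  have hasum : ∑ i, a i = 1 := haΔ.1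
  have hapos := haΔ.2
  have hd : 0 < d := by
    rcases Nat.eq_zero_or_pos d with rfl | h
    · simp at hasum
    · exact h
  have hd0 : (0 : ℝ) < d := by exact_mod_cast hd
  have hab : inner ℝ u a = b := by
    have : a ∈ (H : Set (EuclideanSpace ℝ (Fin d))) := haH
    rw [hHeq] at this
    exact this.2
  rw [hHeq] at hmax
  rw [pow_mul_exp_logSum hapos]
  by_cases hcase : ∀ i, d * a i = 1
  · -- The maximum is at the center, the gradient says nothing about `H`, and the upper bound is `1`.
    have hai (i : Fin d) : a i = 1 / d := by rw [eq_div_iff hd0.ne', mul_comm, hcase i]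
    have hbsum : ∑ i, u i = d * b := by
      rw [← hab, inner_eq_sum]
      simp only [hai, ← Finset.sum_mul]
      field_simp
    set w : Fin d → ℝ := fun i => u i - b with hw
    have hwx (x) (hx : x ∈ ambient d) : ∑ i, w i * x i = inner ℝ u x - b := by
      have hx' : ∑ i, x i = 1 := hx
      simp only [hw, sub_mul, Finset.sum_sub_distrib, ← Finset.mul_sum, hx', inner_eq_sum, mul_one]
    have hwsum : ∑ i, w i = 0 := by simp [hw, Finset.sum_sub_distrib, hbsum]
    have hwne : w ≠ 0 := by
      -- otherwise `H` is the whole ambient hyperplane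
      intro h0
      have hHA : H = ambient d := by
        refine SetLike.coe_injective (hHeq.trans ?_)
        ext x
        refine ⟨fun h => h.1, fun h => ⟨h, ?_⟩⟩
        have := hwx x h
        simp only [h0, Pi.zero_apply, zero_mul, Finset.sum_const_zero] at this
        linarith
      have := hH.codim_one
      rw [hHA] at this
      omega
    rw [vol_inter_halfspace_div_vol hd w fun x hx => by rw [hwx x hx, sub_neg],
      Finset.prod_congr rfl fun i _ => hcase i, Finset.prod_const_one, mul_one]
    refine ⟨measureReal_le_one, ?_⟩
    -- The cone does not change when its normal is rescaled, here to have all entries at least `-1`.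
    set S := 1 + ∑ i, |w i| with hS
    have hSpos : 0 < S := by positivity
    have hlow := (le_tiltedMass_of_sum_eq_zero (fun i => -w i / S)
      (by rw [← Finset.sum_div, Finset.sum_neg_distrib, hwsum]; simp)
      (fun h => hwne (funext fun i => by
        have := congrFun h i
        simpa [hSpos.ne'] using this))
      (fun i => by
        rw [le_div_iff₀ hSpos]
        have := Finset.single_le_sum (f := fun i => |w i|) (fun i _ => abs_nonneg _)
          (Finset.mem_univ i)
        linarith [le_abs_self (w i)])).trans (tiltedMass_le_measure _)
    have hset : {y : Fin d → ℝ | 0 < ∑ i, -w i / S * y i} = {x | ∑ i, w i * x i < 0} := by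
      ext y
      have : ∑ i, -w i / S * y i = (-∑ i, w i * y i) / S := by
        rw [← Finset.sum_neg_distrib, Finset.sum_div]
        exact Finset.sum_congr rfl fun i _ => by ring
      simp [this, div_pos_iff_of_pos_right hSpos]
    rw [hset] at hlow
    exact (ENNReal.ofReal_le_iff_le_toReal (measure_ne_top _ _)).1 hlow
  · obtain ⟨l, m, hlm⟩ := exists_one_div_eq_of_isMaxOn haΔ hab hmax
    have hx (x : EuclideanSpace ℝ (Fin d)) (hx : x ∈ ambient d) :
        ∑ i, 1 / a i * x i = l * inner ℝ u x + m := by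
      have hx' : ∑ i, x i = 1 := hx
      simp only [hlm, add_mul, Finset.sum_add_distrib, ← Finset.mul_sum, hx', inner_eq_sum,
        mul_assoc, mul_one]
    have hla : l * b + m = d := by
      rw [← hab, ← hx a haΔ.1]
      simp [(hapos _).ne']
    have hcA : center d ∈ ambient d := sum_center hd
    -- If `l ≤ 0`, then `center d ∉ Hminus` makes the harmonic mean of `a` at least `1 / d`, which is
    -- only possible at the center.
    have hlpos : 0 < l := by
      by_contra! hl
      refine hcase (eq_center_of_sum_one_div_le hapos hasum ?_)
      have hbc : b ≤ inner ℝ u (center d) := by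
        by_contra! hlt
        exact hcenter ⟨hcA, hlt⟩
      have h1 := hx _ hcA
      have h2 : ∑ i, 1 / a i * center d i = (∑ i, 1 / a i) / d := by
        rw [Finset.sum_div]
        exact Finset.sum_congr rfl fun i _ => by simp [SimplexSection.center, div_eq_mul_inv]
      have h3 : (∑ i, 1 / a i) / d ≤ d := by
        rw [← h2, h1, ← hla]
        linarith [mul_le_mul_of_nonpos_left hbc hl]
      rw [div_le_iff₀ hd0] at h3
      linarith
    have hb (i : Fin d) : 0 < d * a i := mul_pos hd0 (hapos i)
    have hiff (x) (hxA : x ∈ ambient d) :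
        inner ℝ u x < b ↔ ∑ i, (1 / (d * a i) - 1) * x i < 0 := by
      have hx' : ∑ i, x i = 1 := hxA
      have h1 : ∑ i, (1 / (d * a i) - 1) * x i = l * (inner ℝ u x - b) / d := by
        have : ∑ i, (1 / (d * a i) - 1) * x i = (∑ i, 1 / a i * x i) / d - ∑ i, x i := by
          rw [Finset.sum_div, ← Finset.sum_sub_distrib]
          refine Finset.sum_congr rfl fun i _ => ?_
          have := (hapos i).ne'
          field_simp
        rw [this, hx x hxA, hx']
        field_simp
        linarith
      rw [h1, div_lt_iff₀ hd0, zero_mul, ← sub_neg (a := inner ℝ u x)]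
      exact ⟨fun h => mul_neg_of_pos_of_neg hlpos h, fun h => by nlinarith⟩
    rw [vol_inter_halfspace_div_vol hd _ hiff]
    have hprod : 0 ≤ ∏ i, d * a i := Finset.prod_nonneg fun i _ => (hb i).le
    have hD1 : tiltedMass (fun i => d * a i - 1) ≤ 1 := (tiltedMass_le_measure _).trans prob_le_one
    have hDlow := le_tiltedMass_of_sum_eq_zero (fun i => d * a i - 1)
      (by simp [Finset.sum_sub_distrib, ← Finset.mul_sum, hasum])
      (fun h => hcase fun i => by
        have := congrFun h i
        simp only [Pi.zero_apply] at this
        linarith)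
      (fun i => by linarith [hb i])
    rw [ENNReal.ofReal_le_iff_le_toReal (ne_top_of_le_ne_top ENNReal.one_ne_top hD1)] at hDlow
    have hD1' : (tiltedMass fun i => d * a i - 1).toReal ≤ 1 :=
      ENNReal.toReal_le_of_le_ofReal zero_le_one (by simpa using hD1)
    rw [Measure.real, expPi_cone_eq_prod_mul_tiltedMass hb, ENNReal.toReal_mul,
      ENNReal.toReal_ofReal hprod]
    exact ⟨mul_le_of_le_one_right hprod hD1', by rw [mul_comm]; gcongr⟩
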